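/- Let $m,n\ge 2$ be integers. All alphabets are finite, and the state complexity $\mathrm{sc}(L)$ of a regular language $L$ is the number of states of its minimal complete deterministic automaton. Let $K\sqcup\!\sqcup L$ denote the shuffle product, i.e. the set of all riffle shuffles of a word of $K$ with a word of $L$, and let $$\mathrm{sc}_{\sqcup\!\sqcup}(m,n)=\max\{\mathrm{sc}(K\sqcup\!\sqcup L)\;:\;K,L\text{ regular over a common finite alphabet},\ \mathrm{sc}(K)=m,\ \mathrm{sc}(L)=n\}.$$ Write $[\ell]=\{0,\dots,\ell-1\}$. Consider vectors $\pi=[\pi_0,\dots,\pi_{\ell-1}]$ of finite sets of positive integers. For a map $h:[\ell]\to[\ell]$ let $\pi\cdot h$ be the vector with entries $(\pi\cdot h)_i=\bigcup_{h(q)=i}\pi_q$; let $\pi^{\uparrow}$ be the vector with entries $(\pi^{\uparrow})_i=\{q+r: q\in\pi_i\}$, where $r=\max\bigcup_q\pi_q$; and let $\cup$ denote entrywise union of vectors. Consider the deterministic automaton whose states are the subsets of $[m]\times[n]$, whose letters are all pairs $(f,g)$ of maps $f:[m]\to[m]$, $g:[n]\to[n]$, whose initial state is $\{(0,0)\}$,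 and in which $(f,g)$ sends $E$ to $\{(f(i),j):(i,j)\in E\}\cup\{(i,g(j)):(i,j)\in E\}$. (This is the automaton for the shuffle product built on the two automata with state sets $[m]$ and $[n]$ and initial states $0$ in which $(f,g)$ acts by $f$ and by $g$; final states play no role here.) With each path starting at $\{(0,0)\}$ associate a pair of vectors of lengths $m$ and $n$: with the empty path associate $([\{1\},\emptyset,\dots,\emptyset],[\{1\},\emptyset,\dots,\emptyset])$; if a path has pair $(\Lambda,P)$ and is extended by a transition labelled $(f,g)$, associate with the extended path the pair $((\Lambda\cdot f)\cup\Lambda^{\uparrow},\;P\cup(P\cdot g)^{\uparrow})$. The pairs obtained are called U-pairs, their set is $\mathcal U_{m,n}$, and $\mathcal U^{(k)}_{m,n}$ is the set of those U-pairs for which $\bigcup_i\lambda_i=\bigcup_j\rho_j=\{1,\dots,2^k\}$, where $\Lambda=[\lambda_0,\dots,\lambda_{m-1}]$ and $P=[\rho_0,\dots,\rho_{n-1}]$. Put $$\mathfrak s(\Lambda,P)=\{(i,j):\lambda_i\cap\rho_j\ne\emptyset\},\qquad \mathbf f(m,n)=2^{mn-1}+2^{(m-1)(n-1)}(2^{m-1}-1)(2^{n-1}-1).$$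 **Theorem.** The maximum $\mathrm{sc}_{\sqcup\!\sqcup}(m,n)$ exists, and $$\mathrm{sc}_{\sqcup\!\sqcup}(m,n)=\#\Big\{\mathfrak s(\Lambda,P)\;:\;(\Lambda,P)\in\bigcup_{k=0}^{\mathbf f(m,n)}\mathcal U^{(k)}_{m,n}\Big\}=\#\{\mathfrak s(\Lambda,P)\;:\;(\Lambda,P)\in\mathcal U_{m,n}\}.$$ -/

import Mathlib

namespace ShuffleSC

/-! ### Languages: shuffle product and state complexity -/

/-- `IsShuffle u v w`: the word `w` is a riffle shuffle of the words `u` and `v`. -/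
inductive IsShuffle {α : Type} : List α → List α → List α → Prop
  | nil : IsShuffle [] [] []
  | left (a : α) {u v w : List α} : IsShuffle u v w → IsShuffle (a :: u) v (a :: w)
  | right (a : α) {u v w : List α} : IsShuffle u v w → IsShuffle u (a :: v) (a :: w)

/-- The shuffle product of two languages over the same alphabet. -/
def shuffle {α : Type} (K L : Language α) : Language α :=
  {w | ∃ u ∈ K, ∃ v ∈ L, IsShuffle u v w}

/-- The state complexity of a regular language: the least number of states of a complete
deterministic automaton recognizing it (it is `0` for a language that is not regular). -/
noncomputable def stateComplexity {α : Type} (L : Language α) : ℕ :=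
  sInf {k | ∃ (σ : Type) (_ : Fintype σ) (M : DFA α σ), Fintype.card σ = k ∧ M.accepts = L}

/-- The values `sc(K ⧢ L)`, for `K` and `L` regular languages over a common finite alphabet whose
state complexities are exactly `m` and `n`. -/
def shuffleComplexities (m n : ℕ) : Set ℕ :=
  {c | ∃ (α : Type) (_ : Finite α) (K L : Language α),
    K.IsRegular ∧ stateComplexity K = m ∧ L.IsRegular ∧ stateComplexity L = n ∧
      stateComplexity (shuffle K L) = c}

/-- The state complexity of the shuffle operation: the largest of the values above. -/
noncomputable def scShuffle (m n : ℕ) : ℕ := sSup (shuffleComplexities m n)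

/-! ### Monsters, the shuffle modifier, and paths -/

/-- The common alphabet of a 2-monster: pairs of transformations. -/
abbrev Letter (m n : ℕ) : Type := (Fin m → Fin m) × (Fin n → Fin n)

/-- The left automaton of a 2-monster, with set of final states `F`. -/
def leftMonster (m n : ℕ) [NeZero m] (F : Set (Fin m)) : DFA (Letter m n) (Fin m) where
  step q a := a.1 q
  start := 0
  accept := F

/-- The right automaton of a 2-monster, with set of final states `F`. -/
def rightMonster (m n : ℕ) [NeZero n] (F : Set (Fin n)) : DFA (Letter m n) (Fin n) where
  step q a := a.2 q
  start := 0
  accept := F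

/-- The shuffle modifier: the deterministic automaton on sets of pairs of states that
recognizes the shuffle product of the two languages. -/
def shuf {α σ τ : Type} (A : DFA α σ) (B : DFA α τ) : DFA α (Set (σ × τ)) where
  step E a := (fun q => (A.step q.1 a, q.2)) '' E ∪ (fun q => (q.1, B.step q.2 a)) '' E
  start := {(A.start, B.start)}
  accept := {E | (E ∩ A.accept ×ˢ B.accept).Nonempty}

/-- A labelled transition. -/
structure Transition (α σ : Type) where
  src : σ
  label : α
  tgt : σ

/-- `IsPath M q p q'`: the sequence `p` of transitions is a path from `q` to `q'` in `M`. -/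
def IsPath {α σ : Type} (M : DFA α σ) : σ → List (Transition α σ) → σ → Prop
  | q, [], q' => q = q'
  | q, t :: p, q' => t.src = q ∧ t.tgt = M.step q t.label ∧ IsPath M t.tgt p q'

/-! ### U-pairs -/

/-- A vector `[π₀, …, π_{ℓ-1}]` of finite sets of natural numbers. -/
abbrev SetVec (l : ℕ) : Type := Fin l → Finset ℕ

namespace SetVec

/-- The union of the entries. -/
def support {l : ℕ} (v : SetVec l) : Finset ℕ := Finset.univ.biUnion v

/-- `v · h`: the entry of index `i` is the union of the `v q` with `h q = i`. -/
def act {l : ℕ} (v : SetVec l) (h : Fin l → Fin l) : SetVec l :=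
  fun i => (Finset.univ.filter fun q => h q = i).biUnion v

/-- `v↑`: add to all numbers the largest number that occurs in `v`. -/
def shift {l : ℕ} (v : SetVec l) : SetVec l :=
  fun i => (v i).image fun q => q + v.support.sup id

/-- Entrywise union. -/
def union {l : ℕ} (v w : SetVec l) : SetVec l := fun i => v i ∪ w i

/-- The vector `[{1}, ∅, …, ∅]`. -/
def init (l : ℕ) [NeZero l] : SetVec l := fun i => if i = 0 then {1} else ∅

end SetVec

/-- The pair of vectors associated with a path: it is `([{1},∅,…,∅], [{1},∅,…,∅])` for the empty
path, and each further transition, with label `(f, g)`, sends `(Λ, P)` to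
`((Λ · f) ∪ Λ↑, P ∪ (P · g)↑)`. -/
def pathPair (m n : ℕ) [NeZero m] [NeZero n]
    (p : List (Transition (Letter m n) (Set (Fin m × Fin n)))) : SetVec m × SetVec n :=
  p.foldl
    (fun v t =>
      ((v.1.act t.label.1).union v.1.shift, v.2.union (v.2.act t.label.2).shift))
    (SetVec.init m, SetVec.init n)

/-- The set of U-pairs: the pairs associated with the paths of source `{(0, 0)}` in the shuffle
automaton of a 2-monster. -/
def uPairs (m n : ℕ) [NeZero m] [NeZero n] : Set (SetVec m × SetVec n) :=
  {v | ∃ (F₁ : Set (Fin m)) (F₂ : Set (Fin n)) (E : Set (Fin m × Fin n))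
      (p : List (Transition (Letter m n) (Set (Fin m × Fin n)))),
    IsPath (shuf (leftMonster m n F₁) (rightMonster m n F₂)) {(0, 0)} p E ∧
      pathPair m n p = v}

/-- The graded component of the set of U-pairs: both vectors have union `{1, …, 2 ^ k}`. -/
def uPairsGraded (m n : ℕ) [NeZero m] [NeZero n] (k : ℕ) : Set (SetVec m × SetVec n) :=
  {v ∈ uPairs m n | v.1.support = Finset.Icc 1 (2 ^ k) ∧ v.2.support = Finset.Icc 1 (2 ^ k)}

/-- The tableau `{(i, j) | λᵢ ∩ ρⱼ ≠ ∅}` realised by a pair of vectors. -/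
def tableau {m n : ℕ} (v : SetVec m × SetVec n) : Set (Fin m × Fin n) :=
  {c | (v.1 c.1 ∩ v.2 c.2).Nonempty}

/-- The number of valid tableaux, `2^(mn-1) + 2^((m-1)(n-1)) (2^(m-1)-1) (2^(n-1)-1)`. -/
def validBound (m n : ℕ) : ℕ :=
  2 ^ (m * n - 1) + 2 ^ ((m - 1) * (n - 1)) * (2 ^ (m - 1) - 1) * (2 ^ (n - 1) - 1)

end ShuffleSC

/-! Both counts equal the number of sets reachable in the shuffle automaton of the 2-monster
(`reachableTableaux`). This number is an upper bound because in any two automata on `Fin m` and `Fin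
n` starting at `0` each letter acts as a pair of maps, hence as a letter of the monster
(`stateComplexity_shuffle_le`). It is attained because, with one final state on each side, all sets
of pairs are distinguishable (`acceptsFrom_shuf_monster_injective`).

The U-pair of a word of length `k` encodes the set it reaches: each number in `{1, …, 2 ^ k}` labels
one way of distributing the `k` letters between the two automata, and its positions in the two
vectors are the resulting states (`tableau_wordPair`). Finally, a shortest word to a reachable set
is shorter than the number of such sets, which is at most `validBound m n`, so small grades suffice.
-/

namespace ShuffleSC

/-! ### State complexity and reachable states -/

section StateComplexity

variable {α σ : Type}

/-- The restriction of a deterministic automaton to its reachable states. -/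
def reachablePart (M : DFA α σ) : DFA α (Set.range M.eval) where
  step s a := ⟨M.step s.1 a, by
    obtain ⟨w, hw⟩ := s.2
    exact ⟨w ++ [a], by rw [DFA.eval_append_singleton, hw]⟩⟩
  start := ⟨M.start, [], rfl⟩
  accept := Subtype.val ⁻¹' M.accept

theorem coe_evalFrom_reachablePart (M : DFA α σ) (s : Set.range M.eval) (w : List α) :
    ((reachablePart M).evalFrom s w : σ) = M.evalFrom s w := by
  induction w generalizing s with
  | nil => rfl
  | cons a w ih => exact ih _

theorem accepts_reachablePart (M : DFA α σ) : (reachablePart M).accepts = M.accepts := by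
  ext w
  change ((reachablePart M).evalFrom _ w : σ) ∈ M.accept ↔ _
  rw [coe_evalFrom_reachablePart]
  rfl

theorem exists_eval_eq_length_lt [Finite σ] (M : DFA α σ) {s : σ} (hs : s ∈ Set.range M.eval) :
    ∃ w, M.eval w = s ∧ w.length < (Set.range M.eval).ncard := by
  classical
  let := Fintype.ofFinite (Set.range M.eval)
  have hex : ∃ k w, M.eval w = s ∧ w.length = k := by
    obtain ⟨w, hw⟩ := hs
    exact ⟨_, w, hw, rfl⟩
  obtain ⟨w, hw, hk⟩ := Nat.find_spec hex
  refine ⟨w, hw, ?_⟩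
  by_contra! hlt
  rw [← Nat.card_coe_set_eq, Nat.card_eq_fintype_card] at hlt
  -- A word this long visits some reachable state twice; deleting the loop `b` contradicts
  -- minimality.
  obtain ⟨q, a, b, c, rfl, -, hb, ha, hbq, hc⟩ :=
    (reachablePart M).evalFrom_split (s := (reachablePart M).start) hlt rfl
  have hac : M.eval (a ++ c) = s := by
    rw [← hw]
    change M.evalFrom ((reachablePart M).start : σ) _ = M.evalFrom ((reachablePart M).start : σ) _
    rw [← coe_evalFrom_reachablePart, ← coe_evalFrom_reachablePart, ← hc, DFA.evalFrom_of_append,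
      ha]
  have hmin := Nat.find_min' hex ⟨_, hac, rfl⟩
  have hpos := List.length_pos_iff.2 hb
  simp only [List.length_append] at hmin hk
  omega

theorem stateComplexity_le_ncard_range_eval [Finite σ] (M : DFA α σ) :
    stateComplexity M.accepts ≤ (Set.range M.eval).ncard := by
  let := Fintype.ofFinite (Set.range M.eval)
  refine Nat.sInf_le ⟨Set.range M.eval, inferInstance, reachablePart M, ?_,
    accepts_reachablePart M⟩
  rw [← Nat.card_coe_set_eq, Nat.card_eq_fintype_card]

theorem exists_dfa_card_eq_stateComplexity {L : Language α} (hL : L.IsRegular) :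
    ∃ (σ : Type) (_ : Fintype σ) (M : DFA α σ),
      Fintype.card σ = stateComplexity L ∧ M.accepts = L := by
  obtain ⟨σ, hσ, M, hM⟩ := hL
  exact Nat.sInf_mem (s := {k | ∃ (σ : Type) (_ : Fintype σ) (M : DFA α σ),
    Fintype.card σ = k ∧ M.accepts = L}) ⟨_, σ, hσ, M, rfl, hM⟩

/-- Pairwise distinguishable states: the state complexity is the number of reachable states. -/
theorem stateComplexity_eq_ncard_range_eval [Finite σ] (M : DFA α σ)
    (hM : Function.Injective M.acceptsFrom) :
    stateComplexity M.accepts = (Set.range M.eval).ncard := by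
  classical
  refine (stateComplexity_le_ncard_range_eval M).antisymm ?_
  have hreg : M.accepts.IsRegular := ⟨σ, Fintype.ofFinite σ, M, rfl⟩
  obtain ⟨τ, _, N, hcard, hN⟩ := exists_dfa_card_eq_stateComplexity hreg
  rw [← hcard, ← Nat.card_eq_fintype_card, ← Nat.card_coe_set_eq]
  choose word hword using fun s : Set.range M.eval => s.2
  -- Myhill–Nerode: words reaching the same state of `N` have the same left quotient of the
  -- language.
  refine Nat.card_le_card_of_injective (fun s => N.eval (word s)) fun s t hst => ?_
  have hquot (s : Set.range M.eval) (v : List α) :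
      v ∈ M.acceptsFrom s ↔ N.evalFrom (N.eval (word s)) v ∈ N.accept := by
    rw [DFA.mem_acceptsFrom, ← hword s, DFA.eval, DFA.eval, ← DFA.evalFrom_of_append,
      ← DFA.evalFrom_of_append]
    change _ ∈ M.accepts ↔ _ ∈ N.accepts
    rw [hN]
  refine Subtype.ext (hM ?_)
  ext v
  rw [hquot, hquot]
  exact iff_of_eq (congrArg (fun q => N.evalFrom q v ∈ N.accept) hst)

/-- A regular language of state complexity `m` is recognized by an automaton with states `Fin m`
and initial state `0`. -/
theorem exists_dfa_fin {L : Language α} (hL : L.IsRegular) {m : ℕ} [NeZero m]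
    (hm : stateComplexity L = m) : ∃ M : DFA α (Fin m), M.start = 0 ∧ M.accepts = L := by
  obtain ⟨σ, _, M, hcard, hM⟩ := exists_dfa_card_eq_stateComplexity hL
  let e := Fintype.equivFinOfCardEq (hcard.trans hm)
  -- The swap renames the initial state to `0`.
  refine ⟨DFA.reindex (e.trans (Equiv.swap (e M.start) 0)) M, ?_, ?_⟩
  · simp
  · rw [DFA.accepts_reindex, hM]

end StateComplexity

/-! ### The shuffle automaton -/

section Shuffle

variable {α σ τ : Type}

theorem isShuffle_nil_iff {u v : List α} : IsShuffle u v [] ↔ u = [] ∧ v = [] := by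
  constructor
  · rintro ⟨⟩
    exact ⟨rfl, rfl⟩
  · rintro ⟨rfl, rfl⟩
    exact .nil

theorem isShuffle_cons_iff {u v w : List α} {a : α} :
    IsShuffle u v (a :: w) ↔
      (∃ u', u = a :: u' ∧ IsShuffle u' v w) ∨ ∃ v', v = a :: v' ∧ IsShuffle u v' w := by
  constructor
  · rintro (_ | ⟨_, h⟩ | ⟨_, h⟩)
    · exact .inl ⟨_, rfl, h⟩
    · exact .inr ⟨_, rfl, h⟩
  · rintro (⟨u', rfl, h⟩ | ⟨v', rfl, h⟩)
    · exact .left a h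
    · exact .right a h

theorem mem_shuf_step {A : DFA α σ} {B : DFA α τ} {E : Set (σ × τ)} {a : α} {c : σ × τ} :
    c ∈ (shuf A B).step E a ↔
      ∃ q ∈ E, (A.step q.1 a, q.2) = c ∨ (q.1, B.step q.2 a) = c := by
  change c ∈ _ '' E ∪ _ '' E ↔ _
  simp only [Set.mem_union, Set.mem_image]
  constructor
  · rintro (⟨q, hq, h⟩ | ⟨q, hq, h⟩)
    · exact ⟨q, hq, .inl h⟩
    · exact ⟨q, hq, .inr h⟩
  · rintro ⟨q, hq, h | h⟩
    · exact .inl ⟨q, hq, h⟩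
    · exact .inr ⟨q, hq, h⟩

theorem mem_acceptsFrom_shuf (A : DFA α σ) (B : DFA α τ) (E : Set (σ × τ)) (w : List α) :
    w ∈ (shuf A B).acceptsFrom E ↔
      ∃ q ∈ E, ∃ u ∈ A.acceptsFrom q.1, ∃ v ∈ B.acceptsFrom q.2, IsShuffle u v w := by
  induction w generalizing E with
  | nil =>
    change (E ∩ A.accept ×ˢ B.accept).Nonempty ↔ _
    constructor
    · rintro ⟨q, hq, hA, hB⟩
      exact ⟨q, hq, [], hA, [], hB, .nil⟩
    · rintro ⟨q, hq, u, hu, v, hv, h⟩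
      obtain ⟨rfl, rfl⟩ := isShuffle_nil_iff.1 h
      exact ⟨q, hq, hu, hv⟩
  | cons a w ih =>
    change w ∈ (shuf A B).acceptsFrom ((shuf A B).step E a) ↔ _
    rw [ih]
    constructor
    · rintro ⟨c, hc, u, hu, v, hv, h⟩
      obtain ⟨q, hq, rfl | rfl⟩ := mem_shuf_step.1 hc
      · exact ⟨q, hq, a :: u, hu, v, hv, .left a h⟩
      · exact ⟨q, hq, u, hu, a :: v, hv, .right a h⟩
    · rintro ⟨q, hq, u, hu, v, hv, h⟩
      obtain ⟨u', rfl, h'⟩ | ⟨v', rfl, h'⟩ := isShuffle_cons_iff.1 h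
      · exact ⟨_, mem_shuf_step.2 ⟨q, hq, .inl rfl⟩, u', hu, v, hv, h'⟩
      · exact ⟨_, mem_shuf_step.2 ⟨q, hq, .inr rfl⟩, u, hu, v', hv, h'⟩

theorem accepts_shuf (A : DFA α σ) (B : DFA α τ) :
    (shuf A B).accepts = shuffle A.accepts B.accepts := by
  ext w
  refine (mem_acceptsFrom_shuf A B _ w).trans ⟨?_, ?_⟩
  · rintro ⟨q, hq, u, hu, v, hv, h⟩
    obtain rfl : q = (A.start, B.start) := hq
    exact ⟨u, hu, v, hv, h⟩
  · rintro ⟨u, hu, v, hv, h⟩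
    exact ⟨_, rfl, u, hu, v, hv, h⟩

end Shuffle

/-! ### Monsters -/

section Monsters

variable {m n : ℕ}

theorem stateComplexity_accepts_leftMonster [NeZero m] (hm : 2 ≤ m) (x : Fin m) :
    stateComplexity (leftMonster m n {x}).accepts = m := by
  have : Nontrivial (Fin m) := Fin.nontrivial_iff_two_le.2 hm
  obtain ⟨y, hy⟩ := exists_ne x
  rw [stateComplexity_eq_ncard_range_eval]
  · have : Set.range (leftMonster m n {x}).eval = Set.univ :=
      Set.eq_univ_of_forall fun q => ⟨[(fun _ => q, id)], rfl⟩
    rw [this, Set.ncard_univ, Nat.card_fin]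
  · intro s t hst
    let a : Letter m n := (fun q => if q = s then x else y, id)
    have hs : [a] ∈ (leftMonster m n {x}).acceptsFrom s := by
      change (if s = s then x else y) = x
      rw [if_pos rfl]
    rw [hst] at hs
    replace hs : (if t = s then x else y) = x := hs
    by_contra hne
    rw [if_neg (Ne.symm hne)] at hs
    exact hy hs

theorem stateComplexity_accepts_rightMonster [NeZero n] (hn : 2 ≤ n) (x : Fin n) :
    stateComplexity (rightMonster m n {x}).accepts = n := by
  have : Nontrivial (Fin n) := Fin.nontrivial_iff_two_le.2 hn
  obtain ⟨y, hy⟩ := exists_ne x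
  rw [stateComplexity_eq_ncard_range_eval]
  · have : Set.range (rightMonster m n {x}).eval = Set.univ :=
      Set.eq_univ_of_forall fun q => ⟨[(id, fun _ => q)], rfl⟩
    rw [this, Set.ncard_univ, Nat.card_fin]
  · intro s t hst
    let a : Letter m n := (id, fun q => if q = s then x else y)
    have hs : [a] ∈ (rightMonster m n {x}).acceptsFrom s := by
      change (if s = s then x else y) = x
      rw [if_pos rfl]
    rw [hst] at hs
    replace hs : (if t = s then x else y) = x := hs
    by_contra hne
    rw [if_neg (Ne.symm hne)] at hs
    exact hy hs

variable [NeZero m] [NeZero n]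

/-- The states reachable in the shuffle automaton of a 2-monster. -/
def reachableTableaux (m n : ℕ) [NeZero m] [NeZero n] : Set (Set (Fin m × Fin n)) :=
  Set.range (shuf (leftMonster m n ∅) (rightMonster m n ∅)).eval

/-- Final states do not enter the transitions, so `∅` serves as a neutral choice. -/
theorem range_eval_shuf_monster (F₁ : Set (Fin m)) (F₂ : Set (Fin n)) :
    Set.range (shuf (leftMonster m n F₁) (rightMonster m n F₂)).eval = reachableTableaux m n :=
  rfl

theorem stateComplexity_shuffle_le {α : Type} {K L : Language α} (hK : K.IsRegular)
    (hm : stateComplexity K = m) (hL : L.IsRegular) (hn : stateComplexity L = n) :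
    stateComplexity (shuffle K L) ≤ (reachableTableaux m n).ncard := by
  obtain ⟨A, hA, rfl⟩ := exists_dfa_fin hK hm
  obtain ⟨B, hB, rfl⟩ := exists_dfa_fin hL hn
  rw [← accepts_shuf]
  refine (stateComplexity_le_ncard_range_eval _).trans (Set.ncard_le_ncard ?_ (Set.toFinite _))
  rintro _ ⟨w, rfl⟩
  refine ⟨w.map fun a => (fun q => A.step q a, fun q => B.step q a), ?_⟩
  have hstart : (shuf A B).start = {(0, 0)} := by
    change {(A.start, B.start)} = _
    rw [hA, hB]
  rw [DFA.eval, DFA.eval, hstart, DFA.evalFrom, List.foldl_map]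
  rfl

/-- Some word is accepted exactly from the sets that contain a given pair of states. -/
theorem exists_mem_acceptsFrom_shuf_monster_iff (hm : 2 ≤ m) (hn : 2 ≤ n) (x : Fin m) (y : Fin n)
    (c : Fin m × Fin n) :
    ∃ w, ∀ E : Set (Fin m × Fin n),
      w ∈ (shuf (leftMonster m n {x}) (rightMonster m n {y})).acceptsFrom E ↔ c ∈ E := by
  have : Nontrivial (Fin m) := Fin.nontrivial_iff_two_le.2 hm
  have : Nontrivial (Fin n) := Fin.nontrivial_iff_two_le.2 hn
  obtain ⟨i, j⟩ := c
  obtain ⟨x', hx'⟩ := exists_ne x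
  obtain ⟨y', hy'⟩ := exists_ne y
  obtain ⟨j', hj'⟩ := exists_ne j
  -- Only a right move under `b` can end in `(x, y)`, and only from `(x, j)`. Only a left move under
  -- `a` can end in `(x, j)`, and only from `(i, j)`, since right moves land in column `j'`.
  let a : Letter m n := (fun q => if q = i then x else x', fun _ => j')
  let b : Letter m n := (fun _ => x', fun q => if q = j then y else y')
  refine ⟨[a, b], fun E => ?_⟩
  let M := shuf (leftMonster m n {x}) (rightMonster m n {y})
  have hb (E : Set (Fin m × Fin n)) : M.step E b ∈ M.accept ↔ (x, j) ∈ E := by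
    constructor
    · rintro ⟨d, hd, hd₁, hd₂⟩
      replace hd₁ : d.1 = x := hd₁
      replace hd₂ : d.2 = y := hd₂
      obtain ⟨q, hq, rfl | rfl⟩ := mem_shuf_step.1 hd
      · exact absurd hd₁ hx'
      · replace hd₁ : q.1 = x := hd₁
        replace hd₂ : (if q.2 = j then y else y') = y := hd₂
        by_cases hqj : q.2 = j
        · rwa [← hd₁, ← hqj]
        · rw [if_neg hqj] at hd₂
          exact absurd hd₂ hy'
    · intro h
      refine ⟨(x, y), mem_shuf_step.2 ⟨_, h, .inr ?_⟩, rfl, rfl⟩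
      change (x, if j = j then y else y') = (x, y)
      rw [if_pos rfl]
  change M.step (M.step E a) b ∈ M.accept ↔ _
  rw [hb, mem_shuf_step]
  constructor
  · rintro ⟨q, hq, h | h⟩
    · replace h : ((if q.1 = i then x else x'), q.2) = (x, j) := h
      rw [Prod.mk.injEq] at h
      by_cases hqi : q.1 = i
      · rwa [← hqi, ← h.2]
      · rw [if_neg hqi] at h
        exact absurd h.1 hx'
    · exact absurd (congrArg Prod.snd h) hj'
  · intro h
    refine ⟨_, h, .inl ?_⟩
    change ((if i = i then x else x'), j) = (x, j)
    rw [if_pos rfl]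

theorem acceptsFrom_shuf_monster_injective (hm : 2 ≤ m) (hn : 2 ≤ n) (x : Fin m) (y : Fin n) :
    Function.Injective (shuf (leftMonster m n {x}) (rightMonster m n {y})).acceptsFrom := by
  intro E E' h
  ext c
  obtain ⟨w, hw⟩ := exists_mem_acceptsFrom_shuf_monster_iff hm hn x y c
  rw [← hw, ← hw, h]

theorem isGreatest_shuffleComplexities (hm : 2 ≤ m) (hn : 2 ≤ n) :
    IsGreatest (shuffleComplexities m n) (reachableTableaux m n).ncard := by
  constructor
  · refine ⟨Letter m n, inferInstance, (leftMonster m n {0}).accepts,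
      (rightMonster m n {0}).accepts, ⟨_, inferInstance, _, rfl⟩,
      stateComplexity_accepts_leftMonster hm 0, ⟨_, inferInstance, _, rfl⟩,
      stateComplexity_accepts_rightMonster hn 0, ?_⟩
    rw [← accepts_shuf, stateComplexity_eq_ncard_range_eval _
      (acceptsFrom_shuf_monster_injective hm hn 0 0), range_eval_shuf_monster]
  · rintro _ ⟨α, _, K, L, hK, hKm, hL, hLn, rfl⟩
    exact stateComplexity_shuffle_le hK hKm hL hLn

/-! ### The number of valid tableaux -/

/-- A left move preserves the column and a right move preserves the row, so neither index `0` is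
ever lost. -/
theorem exists_mem_zero_of_mem_reachableTableaux {E : Set (Fin m × Fin n)}
    (hE : E ∈ reachableTableaux m n) : (∃ i, (i, 0) ∈ E) ∧ ∃ j, (0, j) ∈ E := by
  obtain ⟨w, rfl⟩ := hE
  induction w using List.reverseRecOn with
  | nil => exact ⟨⟨0, rfl⟩, ⟨0, rfl⟩⟩
  | append_singleton w a ih =>
    obtain ⟨⟨i, hi⟩, ⟨j, hj⟩⟩ := ih
    rw [DFA.eval_append_singleton]
    exact ⟨⟨_, mem_shuf_step.2 ⟨_, hi, .inl rfl⟩⟩, ⟨_, mem_shuf_step.2 ⟨_, hj, .inr rfl⟩⟩⟩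

theorem card_subtype_ne {α : Type*} [Finite α] (a : α) :
    Nat.card {x // x ≠ a} = Nat.card α - 1 := by
  have h := Set.ncard_compl ({a} : Set α)
  rwa [Set.ncard_singleton, ← Nat.card_coe_set_eq] at h

theorem card_set {α : Type*} [Finite α] : Nat.card (Set α) = 2 ^ Nat.card α := by
  have := Fintype.ofFinite α
  classical
  rw [Nat.card_eq_fintype_card, Nat.card_eq_fintype_card, Fintype.card_set]

/-- Split on whether `(0, 0)` belongs to `E`. If so, the other cells are free; if not, the rest of
row `0` and of column `0` must each be nonempty, and the cells outside them are free. -/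
theorem ncard_valid_le (m n : ℕ) [NeZero m] [NeZero n] :
    {E : Set (Fin m × Fin n) | (∃ i, (i, 0) ∈ E) ∧ ∃ j, (0, j) ∈ E}.ncard ≤ validBound m n := by
  let S : Set (Set (Fin m × Fin n)) := {E | (0, 0) ∈ E}
  let T : Set (Set (Fin m × Fin n)) :=
    {E | (0, 0) ∉ E ∧ (∃ i, (i, 0) ∈ E) ∧ ∃ j, (0, j) ∈ E}
  have hS : S.ncard ≤ 2 ^ (m * n - 1) := by
    let f (E : Set (Fin m × Fin n)) : Set {c : Fin m × Fin n // c ≠ (0, 0)} := Subtype.val ⁻¹' E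
    have h := Set.ncard_le_ncard_of_injOn (s := S) (t := Set.univ) f (fun _ _ => trivial) (by
      intro E hE E' hE' h
      ext c
      by_cases hc : c = (0, 0)
      · subst hc
        exact iff_of_true hE hE'
      · exact iff_of_eq (congrArg (fun s => (⟨c, hc⟩ : {c // c ≠ _}) ∈ s) h))
    rwa [Set.ncard_univ, card_set, card_subtype_ne, Nat.card_prod, Nat.card_fin, Nat.card_fin]
      at h
  have hT : T.ncard ≤ 2 ^ ((m - 1) * (n - 1)) * ((2 ^ (m - 1) - 1) * (2 ^ (n - 1) - 1)) := by
    let X := {i : Fin m // i ≠ 0}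
    let Y := {j : Fin n // j ≠ 0}
    let f (E : Set (Fin m × Fin n)) : Set (X × Y) × Set X × Set Y :=
      ((fun p => (p.1.1, p.2.1)) ⁻¹' E, (fun i => (i.1, 0)) ⁻¹' E, (fun j => (0, j.1)) ⁻¹' E)
    have h := Set.ncard_le_ncard_of_injOn (s := T)
      (t := (Set.univ : Set (Set (X × Y))) ×ˢ ({∅}ᶜ : Set (Set X)) ×ˢ ({∅}ᶜ : Set (Set Y))) f
      (by
        rintro E ⟨h0, ⟨i, hi⟩, ⟨j, hj⟩⟩
        have hi0 : i ≠ 0 := by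
          rintro rfl
          exact h0 hi
        have hj0 : j ≠ 0 := by
          rintro rfl
          exact h0 hj
        refine ⟨trivial, fun h => ?_, fun h => ?_⟩
        · exact (Set.eq_empty_iff_forall_notMem.1 h) ⟨i, hi0⟩ hi
        · exact (Set.eq_empty_iff_forall_notMem.1 h) ⟨j, hj0⟩ hj)
      (by
        rintro E hE E' hE' h
        obtain ⟨h₁, h₂⟩ := Prod.mk.inj h
        obtain ⟨h₂, h₃⟩ := Prod.mk.inj h₂
        ext ⟨i, j⟩
        by_cases hi : i = 0 <;> by_cases hj : j = 0
        · subst hi hj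
          exact iff_of_false hE.1 hE'.1
        · subst hi
          exact iff_of_eq (congrArg (fun s => (⟨j, hj⟩ : Y) ∈ s) h₃)
        · subst hj
          exact iff_of_eq (congrArg (fun s => (⟨i, hi⟩ : X) ∈ s) h₂)
        · exact iff_of_eq (congrArg (fun s => ((⟨i, hi⟩, ⟨j, hj⟩) : X × Y) ∈ s) h₁))
    rwa [Set.ncard_prod, Set.ncard_prod, Set.ncard_univ, Set.ncard_compl, Set.ncard_compl,
      Set.ncard_singleton, Set.ncard_singleton, card_set, card_set, card_set, Nat.card_prod,
      card_subtype_ne, card_subtype_ne, Nat.card_fin, Nat.card_fin] at h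
  refine (Set.ncard_le_ncard (t := S ∪ T) ?_ (Set.toFinite _)).trans
    ((Set.ncard_union_le S T).trans ?_)
  · intro E hE
    by_cases h : (0, 0) ∈ E
    · exact .inl h
    · exact .inr ⟨h, hE⟩
  · rw [validBound, mul_assoc]
    exact add_le_add hS hT

theorem ncard_reachableTableaux_le (m n : ℕ) [NeZero m] [NeZero n] :
    (reachableTableaux m n).ncard ≤ validBound m n :=
  (Set.ncard_le_ncard (fun _ hE => exists_mem_zero_of_mem_reachableTableaux hE)
    (Set.toFinite _)).trans (ncard_valid_le m n)

end Monsters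

/-! ### U-pairs -/

namespace SetVec

variable {l : ℕ}

theorem mem_support {v : SetVec l} {r : ℕ} : r ∈ v.support ↔ ∃ i, r ∈ v i := by
  simp [support]

theorem mem_act {v : SetVec l} {h : Fin l → Fin l} {i : Fin l} {r : ℕ} :
    r ∈ v.act h i ↔ ∃ q, h q = i ∧ r ∈ v q := by
  simp [act]

theorem mem_union {v w : SetVec l} {i : Fin l} {r : ℕ} : r ∈ v.union w i ↔ r ∈ v i ∨ r ∈ w i :=
  Finset.mem_union

theorem support_init (l : ℕ) [NeZero l] : (init l).support = Finset.Icc 1 1 := by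
  ext r
  rw [mem_support]
  constructor
  · rintro ⟨i, hi⟩
    rw [init] at hi
    split_ifs at hi
    · simpa using hi
    · simp at hi
  · intro hr
    exact ⟨0, by simpa [init] using hr⟩

theorem support_act (v : SetVec l) (h : Fin l → Fin l) : (v.act h).support = v.support := by
  ext r
  simp only [mem_support, mem_act]
  constructor
  · rintro ⟨i, q, -, hq⟩
    exact ⟨q, hq⟩
  · rintro ⟨q, hq⟩
    exact ⟨h q, q, rfl, hq⟩

theorem sup_Icc_id {N : ℕ} : (Finset.Icc 1 N).sup id = N := by
  refine le_antisymm (Finset.sup_le fun r hr => (Finset.mem_Icc.1 hr).2) ?_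
  rcases Nat.eq_zero_or_pos N with rfl | hN
  · exact Nat.zero_le _
  · exact Finset.le_sup (f := id) (Finset.mem_Icc.2 ⟨hN, le_rfl⟩)

theorem mem_shift {v : SetVec l} {N : ℕ} (hv : v.support = Finset.Icc 1 N) {i : Fin l} {r : ℕ} :
    r ∈ v.shift i ↔ ∃ q ∈ v i, q + N = r := by
  rw [shift, hv, sup_Icc_id, Finset.mem_image]

theorem mem_Icc_of_mem {v : SetVec l} {N : ℕ} (hv : v.support = Finset.Icc 1 N) {i : Fin l}
    {r : ℕ} (hr : r ∈ v i) : 1 ≤ r ∧ r ≤ N :=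
  Finset.mem_Icc.1 (hv ▸ mem_support.2 ⟨i, hr⟩)

theorem support_union_shift {v w : SetVec l} {N : ℕ} (hv : v.support = Finset.Icc 1 N)
    (hw : w.support = Finset.Icc 1 N) : (v.union w.shift).support = Finset.Icc 1 (N * 2) := by
  ext r
  simp only [mem_support, mem_union, mem_shift hw, Finset.mem_Icc]
  constructor
  · rintro ⟨i, h | ⟨q, hq, rfl⟩⟩
    · have := mem_Icc_of_mem hv h
      omega
    · have := mem_Icc_of_mem hw hq
      omega
  · rintro ⟨h₁, h₂⟩
    rcases le_or_gt r N with h | h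
    · have : r ∈ v.support := hv ▸ Finset.mem_Icc.2 ⟨h₁, h⟩
      obtain ⟨i, hi⟩ := mem_support.1 this
      exact ⟨i, .inl hi⟩
    · have : r - N ∈ w.support := hw ▸ Finset.mem_Icc.2 (by omega)
      obtain ⟨i, hi⟩ := mem_support.1 this
      exact ⟨i, .inr ⟨_, hi, by omega⟩⟩

end SetVec

section UPairs

open SetVec

variable {m n : ℕ}

theorem mem_tableau {v : SetVec m × SetVec n} {c : Fin m × Fin n} :
    c ∈ tableau v ↔ ∃ r ∈ v.1 c.1, r ∈ v.2 c.2 := by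
  change (v.1 c.1 ∩ v.2 c.2).Nonempty ↔ _
  simp only [Finset.Nonempty, Finset.mem_inter]

variable [NeZero m] [NeZero n]

/-- The pair of vectors associated with the labels of a path. -/
def wordPair (w : List (Letter m n)) : SetVec m × SetVec n :=
  w.foldl (fun v a => ((v.1.act a.1).union v.1.shift, v.2.union (v.2.act a.2).shift))
    (SetVec.init m, SetVec.init n)

theorem pathPair_eq_wordPair (p : List (Transition (Letter m n) (Set (Fin m × Fin n)))) :
    pathPair m n p = wordPair (p.map Transition.label) := by
  rw [wordPair, List.foldl_map]
  rfl

theorem wordPair_append_singleton (w : List (Letter m n)) (a : Letter m n) :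
    wordPair (w ++ [a]) = (((wordPair w).1.act a.1).union (wordPair w).1.shift,
      (wordPair w).2.union ((wordPair w).2.act a.2).shift) := by
  simp only [wordPair, List.foldl_append, List.foldl_cons, List.foldl_nil]

theorem exists_isPath {α σ : Type} (M : DFA α σ) (q : σ) (w : List α) :
    ∃ p, IsPath M q p (M.evalFrom q w) ∧ p.map Transition.label = w := by
  induction w generalizing q with
  | nil => exact ⟨[], rfl, rfl⟩
  | cons a w ih =>
    obtain ⟨p, hp, rfl⟩ := ih (M.step q a)
    exact ⟨⟨q, a, M.step q a⟩ :: p, ⟨rfl, rfl, hp⟩, rfl⟩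

/-- The associated pair depends only on the labels, and every word labels a path. -/
theorem uPairs_eq_range : uPairs m n = Set.range wordPair := by
  ext v
  constructor
  · rintro ⟨F₁, F₂, E, p, hp, rfl⟩
    exact ⟨_, (pathPair_eq_wordPair p).symm⟩
  · rintro ⟨w, rfl⟩
    obtain ⟨p, hp, rfl⟩ :=
      exists_isPath (shuf (leftMonster m n ∅) (rightMonster m n ∅)) {(0, 0)} w
    exact ⟨∅, ∅, _, p, hp, pathPair_eq_wordPair p⟩

theorem support_wordPair (w : List (Letter m n)) :
    (wordPair w).1.support = Finset.Icc 1 (2 ^ w.length) ∧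
      (wordPair w).2.support = Finset.Icc 1 (2 ^ w.length) := by
  induction w using List.reverseRecOn with
  | nil => exact ⟨support_init m, support_init n⟩
  | append_singleton w a ih =>
    rw [wordPair_append_singleton, List.length_append, List.length_singleton, pow_succ]
    exact ⟨support_union_shift ((support_act _ _).trans ih.1) ih.1,
      support_union_shift ih.2 ((support_act _ _).trans ih.2)⟩

/-- The tableau of the pair of vectors of a path is the state that the path reaches. -/
theorem tableau_wordPair (w : List (Letter m n)) :
    tableau (wordPair w) = (shuf (leftMonster m n ∅) (rightMonster m n ∅)).eval w := by
  induction w using List.reverseRecOn with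
  | nil =>
    ext ⟨i, j⟩
    change _ ↔ (i, j) = (0, 0)
    rw [mem_tableau]
    by_cases hi : i = 0 <;> by_cases hj : j = 0 <;> simp [wordPair, SetVec.init, hi, hj]
  | append_singleton w a ih =>
    obtain ⟨h₁, h₂⟩ := support_wordPair w
    rw [DFA.eval_append_singleton, ← ih, wordPair_append_singleton]
    ext ⟨i, j⟩
    rw [mem_tableau, mem_shuf_step]
    simp only [SetVec.mem_union, mem_shift h₁, mem_shift ((support_act _ a.2).trans h₂), mem_act]
    constructor
    · rintro ⟨r, ⟨q, rfl, hq⟩ | ⟨s, hs, rfl⟩, hr | ⟨t, ⟨q', rfl, hq'⟩, ht⟩⟩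
      · exact ⟨(q, j), mem_tableau.2 ⟨r, hq, hr⟩, .inl rfl⟩
      · have := mem_Icc_of_mem h₁ hq
        have := mem_Icc_of_mem h₂ hq'
        omega
      · have := mem_Icc_of_mem h₁ hs
        have := mem_Icc_of_mem h₂ hr
        omega
      · obtain rfl : t = s := by omega
        exact ⟨(i, q'), mem_tableau.2 ⟨t, hs, hq'⟩, .inr rfl⟩
    · rintro ⟨⟨q, q'⟩, hq, h | h⟩
      · obtain ⟨r, hr, hr'⟩ := mem_tableau.1 hq
        obtain ⟨h', rfl⟩ := Prod.mk.inj h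
        exact ⟨r, .inl ⟨q, h', hr⟩, .inl hr'⟩
      · obtain ⟨r, hr, hr'⟩ := mem_tableau.1 hq
        obtain ⟨rfl, h'⟩ := Prod.mk.inj h
        exact ⟨_, .inr ⟨r, hr, rfl⟩, .inr ⟨r, ⟨q', h', hr'⟩, rfl⟩⟩

theorem tableau_image_uPairs : tableau '' uPairs m n = reachableTableaux m n := by
  rw [uPairs_eq_range, ← Set.range_comp]
  exact congrArg Set.range (funext tableau_wordPair)

/-- The grade of the pair of a word is the length of the word, so short words give small grades. -/
theorem tableau_image_uPairsGraded :
    (tableau '' ⋃ k ∈ Finset.range (validBound m n + 1), uPairsGraded m n k) =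
      reachableTableaux m n := by
  refine Set.Subset.antisymm ?_ fun E hE => ?_
  · rw [← tableau_image_uPairs]
    exact Set.image_mono (Set.iUnion₂_subset fun k _ v hv => hv.1)
  · obtain ⟨w, rfl, hw⟩ :=
      exists_eval_eq_length_lt (shuf (leftMonster m n ∅) (rightMonster m n ∅)) hE
    have hlen : w.length < validBound m n + 1 :=
      (hw.trans_le (ncard_reachableTableaux_le m n)).trans (Nat.lt_succ_self _)
    refine ⟨wordPair w, Set.mem_iUnion₂.2 ⟨w.length, Finset.mem_range.2 hlen, ?_⟩,
      tableau_wordPair w⟩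
    refine ⟨?_, support_wordPair w⟩
    rw [uPairs_eq_range]
    exact Set.mem_range_self w

end UPairs

end ShuffleSC

theorem mainTheorem1 (m n : ℕ) [NeZero m] [NeZero n] (hm : 2 ≤ m) (hn : 2 ≤ n) :
    IsGreatest (ShuffleSC.shuffleComplexities m n) (ShuffleSC.scShuffle m n) ∧
    ShuffleSC.scShuffle m n =
      (ShuffleSC.tableau ''
        ⋃ k ∈ Finset.range (ShuffleSC.validBound m n + 1),
          ShuffleSC.uPairsGraded m n k).ncard ∧
    ShuffleSC.scShuffle m n = (ShuffleSC.tableau '' ShuffleSC.uPairs m n).ncard := by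
  have h := ShuffleSC.isGreatest_shuffleComplexities hm hn
  have hsc : ShuffleSC.scShuffle m n = (ShuffleSC.reachableTableaux m n).ncard := h.csSup_eq
  rw [ShuffleSC.tableau_image_uPairsGraded, ShuffleSC.tableau_image_uPairs, hsc]
  exact ⟨h, rfl, rfl⟩
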